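/- A departing-bandits instance with a single user type consists of $K\ge 1$ categories with click probabilities $P_a\in(0,1)$ and departure probabilities $\Lambda_a\in(0,1]$, $a\in[K]$. Users $t=1,\dots,T$ ($T\ge 2$) arrive one after the other. In each iteration with a user the learner recommends a category $a$; independently of the past, the user clicks with probability $P_a$ (reward $1$, and she stays); if she does not click (reward $0$), she departs with probability $\Lambda_a$ and stays otherwise. A policy maps the history of the interaction with the current user (previous recommendations and clicks) to the next category; its return $V^\pi$ is the number of clicks until the user departs, and $\pi^*$ denotes a policy that maximizes $\mathbb{E}[V^\pi]$ over all policies. The fixed-arm policy $\pi^a$ always recommends $a$. UCB-Hybrid over a finite policy set $\Pi$, with horizon $T$ and parameters $\tilde\tau,\eta$, serves user $t$ with a policy $\pi_t\in\arg\max_{\pi\in\Pi}U_{t-1}(\pi)$ (ties broken arbitrarily, without knowledge of the current or future users' randomness). Here $U_{t}(\pi)=\infty$ if $\pi$ has not been executed on users $1,\dots,t$. Otherwise, if $n$ is the number of times that $\pi$ has been executed on them and $\hat\mu$ the average of the $n$ returns observed, then $$U_t(\pi)=\hat\mu+\frac{8\sqrt{\eta}\,\tilde\tau\ln T}{n}\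 \text{ if } n<8\eta\ln T,\qquad U_t(\pi)=\hat\mu+\sqrt{\frac{8\tilde\tau^2\ln T}{n}}\ \text{ otherwise.}$$ The regret is $R_T=T\cdot\mathbb{E}[V^{\pi^*}]-\sum_{t=1}^T V^{\pi_t}$, where $V^{\pi_t}$ is the return obtained from user $t$. **Theorem.** For every $\epsilon\in(0,1)$ there is a constant $C>0$, depending only on $\epsilon$, such that the following holds for all $K\ge1$, all $T\ge2$ and every single-type instance in which the probability of departing in an iteration is at least $\epsilon$ for every category, i.e. $\Lambda_a(1-P_a)\ge\epsilon$ for all $a\in[K]$ (equivalently, $-8e/\ln(1-\Lambda_a(1-P_a))\le 8e/\ln\frac{1}{1-\epsilon}$ whenever $\Lambda_a(1-P_a)<1$). An optimal policy $\pi^*$ exists and has finite expected return, and running UCB-Hybrid with $\Pi=\{\pi^a: a\in[K]\}$, $\tilde\tau=\dfrac{8e}{\ln\frac{1}{1-\epsilon}}$ and $\eta=1$ gives an integrable regret with $$\mathbb{E}[R_T]\le C\left(\sqrt{KT\log T}+K\log T\right).$$ -/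

import Mathlib

open MeasureTheory ProbabilityTheory
open scoped ENNReal unitInterval

namespace DepartingBandits

/-- A (deterministic) recommendation policy: a map from the history of the interaction with the
current user, i.e. the list of pairs (recommended category, click or no click) of the previous
iterations, to the next category. -/
abbrev Policy (K : ℕ) : Type := List (Fin K × Bool) → Fin K

/-- The fixed-arm policy that recommends the category `a` in every iteration. -/
def fixedArm {K : ℕ} (a : Fin K) : Policy K := fun _ => a

/-- The random coins of one user: `x j a = (click, leave)` says whether the user clicks if the
category `a` is recommended in iteration `j` (iterations are counted from `0`), and whether she
departs in case she does not click on it. -/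
abbrev Coins (K : ℕ) : Type := ℕ → Fin K → Bool × Bool

/-- The law of the coins of a user: all coins are independent, a click on `a` has probability
`P a`, and a departure after a no-click on `a` has probability `L a`. -/
noncomputable def userLaw {K : ℕ} (P L : Fin K → I) : Measure (Coins K) :=
  Measure.infinitePi fun _ : ℕ => Measure.pi fun a : Fin K =>
    (bernoulliMeasure true false (P a)).prod (bernoulliMeasure true false (L a))

/-- The history before iteration `j` when the policy `p` meets the coins `x`. -/
def history {K : ℕ} (p : Policy K) (x : Coins K) : ℕ → List (Fin K × Bool)
  | 0 => []
  | j + 1 => history p x j ++ [(p (history p x j), (x j (p (history p x j))).1)]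

/-- The category recommended in iteration `j`. -/
def category {K : ℕ} (p : Policy K) (x : Coins K) (j : ℕ) : Fin K := p (history p x j)

/-- The user clicks in iteration `j` (if she is still present). -/
def Clicks {K : ℕ} (p : Policy K) (x : Coins K) (j : ℕ) : Prop :=
  (x j (category p x j)).1 = true

/-- The user departs at the end of iteration `j` (if she is still present):
she does not click, and her departure coin says that she leaves. -/
def Departs {K : ℕ} (p : Policy K) (x : Coins K) (j : ℕ) : Prop :=
  ¬ Clicks p x j ∧ (x j (category p x j)).2 = true

/-- The user is still present in iteration `j`. -/
def Present {K : ℕ} (p : Policy K) (x : Coins K) (j : ℕ) : Prop :=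
  ∀ i < j, ¬ Departs p x i

open Classical in
/-- The return of the policy `p` from a user with coins `x`: the number of clicks until she
departs. (It can be infinite only if she never departs.) -/
noncomputable def policyReturn {K : ℕ} (p : Policy K) (x : Coins K) : ℝ≥0∞ :=
  ∑' j : ℕ, if Present p x j ∧ Clicks p x j then 1 else 0

/-- The expected return of a policy. -/
noncomputable def expectedReturn {K : ℕ} (P L : Fin K → I) (p : Policy K) : ℝ≥0∞ :=
  ∫⁻ x, policyReturn p x ∂(userLaw P L)

/-- The policy `p` maximizes the expected return among all policies. -/
def IsOptimal {K : ℕ} (P L : Fin K → I) (p : Policy K) : Prop :=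
  ∀ p' : Policy K, expectedReturn P L p' ≤ expectedReturn P L p

/-- The number of users `s < t` that were served with the `i`-th policy,
`c s` being the index of the policy that user `s` was served with. -/
def count {ι : Type*} [DecidableEq ι] (c : ℕ → ι) (t : ℕ) (i : ι) : ℕ :=
  ((Finset.range t).filter fun s => c s = i).card

/-- The sum of the returns `v s` of the users `s < t` that were served with the `i`-th policy. -/
def total {ι : Type*} [DecidableEq ι] (c : ℕ → ι) (v : ℕ → ℝ) (t : ℕ) (i : ι) : ℝ :=
  ∑ s ∈ (Finset.range t).filter (fun s => c s = i), v s

/-- The upper confidence bound (with hybrid radii) of a policy that has been executed `n` times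
with sum of returns `S`, for the horizon `T` and the parameters `τ` and `η`. -/
noncomputable def ucbIndex (T : ℕ) (τ η : ℝ) (n : ℕ) (S : ℝ) : EReal :=
  if n = 0 then ⊤
  else if (n : ℝ) < 8 * η * Real.log T then
    ((S / n + 8 * √η * τ * Real.log T / n : ℝ) : EReal)
  else
    ((S / n + √(8 * τ ^ 2 * Real.log T / n) : ℝ) : EReal)

/-- `c` is a run of the algorithm UCB-Hybrid with the finite set of policies `pol i`, `i : ι`, the
horizon `T` and the parameters `τ` and `η`, on users `0, 1, …, T - 1` with click-probabilities `P`
and departure-probabilities `L`; `x t` are the coins of user `t`, and `c t` is the index of the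
policy that user `t` is served with. Ties may be broken in any way, possibly at random, that does
not look at the coins of the current user or of later ones. -/
structure IsUCBHybridRun {ι Ω : Type*} [DecidableEq ι] [MeasurableSpace ι] [MeasurableSpace Ω]
    {K : ℕ} (P L : Fin K → I) (pol : ι → Policy K) (T : ℕ) (τ η : ℝ) (μ : Measure Ω)
    (x : ℕ → Ω → Coins K) (c : ℕ → Ω → ι) : Prop where
  measurable_coins : ∀ t < T, Measurable (x t)
  measurable_choice : ∀ t < T, Measurable (c t)
  /-- the coins of each user have the law of the model -/
  law_coins : ∀ t < T, μ.map (x t) = userLaw P L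
  /-- the coins of user `t` are independent of the coins of the earlier users together with all
  choices up to and including the choice of the policy for user `t` -/
  nonanticipating : ∀ t < T,
    IndepFun (fun ω => ((fun s : Fin t => x s ω), (fun s : Fin (t + 1) => c s ω))) (x t) μ
  /-- the chosen policy maximizes the current upper confidence bound -/
  choice_mem_argmax : ∀ t < T, ∀ ω, ∀ i : ι,
    ucbIndex T τ η (count (fun s => c s ω) t i)
        (total (fun s => c s ω) (fun s => (policyReturn (pol (c s ω)) (x s ω)).toReal) t i) ≤
      ucbIndex T τ η (count (fun s => c s ω) t (c t ω))
        (total (fun s => c s ω) (fun s => (policyReturn (pol (c s ω)) (x s ω)).toReal) t (c t ω))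

/-- The regret `T ⬝ 𝔼[V^{pstar}] - ∑ t, V^{π_t}` of serving the users `t < T` with the policies
`pol (c t)`, where `pstar` is an optimal policy. -/
noncomputable def regret {ι Ω : Type*} {K : ℕ} (P L : Fin K → I) (pstar : Policy K)
    (pol : ι → Policy K) (T : ℕ) (x : ℕ → Ω → Coins K) (c : ℕ → Ω → ι) (ω : Ω) : ℝ :=
  T * (expectedReturn P L pstar).toReal
    - ∑ t ∈ Finset.range T, (policyReturn (pol (c t ω)) (x t ω)).toReal

end DepartingBandits

/-! While a user is present, an iteration with `a` yields `P a` clicks and `leaveProb P L a`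
departures in expectation. She departs at most once, so no adaptive policy earns more than the
largest ratio of the two (`expectedReturn_le`), and the fixed arm with that ratio attains it. What
remains is a stochastic bandit whose arms have geometric returns.

These returns are unbounded, but their moment generating function is explicit
(`lintegral_exp_policyReturn`), and the lower bound `ε` on departures makes them sub-exponential
with parameter `τ` (`geometric_subexponential`). Exponential tilts are admissible only up to `1 /
τ`, which is why the confidence radius has two regimes (`exists_tilt`). A supermartingale over the
users (`lintegral_prod_chosen_le_one`), Markov's inequality and a union bound make all confidence
bounds hold outside an event of probability at most `2K/T²`. Off that event an arm costs the trivial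
gap for its first `8 log T` or so executions, and at most twice the radius afterwards
(`gap_le_gapBound`). Summing over executions and applying Cauchy–Schwarz over arms gives the rate
(`integral_regret_le`). -/

namespace DepartingBandits

/-! ### Laws of the coins and independence between iterations. -/

variable {K : ℕ}

/-- The law of the coins of one iteration. -/
noncomputable def roundLaw (P L : Fin K → I) : Measure (Fin K → Bool × Bool) :=
  Measure.pi fun a : Fin K =>
    (bernoulliMeasure true false (P a)).prod (bernoulliMeasure true false (L a))

instance (P L : Fin K → I) : IsProbabilityMeasure (roundLaw P L) := by
  unfold roundLaw; infer_instance

instance (P L : Fin K → I) : IsProbabilityMeasure (userLaw P L) := by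
  unfold userLaw; infer_instance

/-- The probability of a departure in an iteration with category `a`. -/
noncomputable def leaveProb (P L : Fin K → I) (a : Fin K) : ℝ := L a * (1 - P a)

lemma lintegral_bernoulliMeasure (p : I) (h : Bool → ℝ≥0∞) :
    ∫⁻ b, h b ∂(bernoulliMeasure true false p) =
      ENNReal.ofReal p * h true + ENNReal.ofReal (1 - p) * h false := by
  have h1 : ENNReal.ofReal (p : ℝ) = (unitInterval.toNNReal p : ℝ≥0∞) := by
    rw [← unitInterval.coe_toNNReal, ENNReal.ofReal_coe_nnreal]
  have h2 : ENNReal.ofReal (1 - (p : ℝ)) = (unitInterval.toNNReal (σ p) : ℝ≥0∞) := by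
    rw [← unitInterval.coe_symm_eq, ← unitInterval.coe_toNNReal, ENNReal.ofReal_coe_nnreal]
  rw [bernoulliMeasure_def, lintegral_add_measure, lintegral_smul_measure, lintegral_smul_measure,
    lintegral_dirac, lintegral_dirac, h1, h2]
  rfl

lemma lintegral_roundLaw (P L : Fin K → I) (a : Fin K) (h : Bool × Bool → ℝ≥0∞) :
    ∫⁻ y, h (y a) ∂(roundLaw P L) =
      ENNReal.ofReal (P a) *
        (ENNReal.ofReal (L a) * h (true, true) + ENNReal.ofReal (1 - L a) * h (true, false)) +
      ENNReal.ofReal (1 - P a) *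
        (ENNReal.ofReal (L a) * h (false, true) + ENNReal.ofReal (1 - L a) * h (false, false)) := by
  have hm : Measurable h := measurable_of_finite h
  rw [roundLaw, (measurePreserving_eval (fun a : Fin K =>
    (bernoulliMeasure true false (P a)).prod (bernoulliMeasure true false (L a))) a).lintegral_comp
    hm, lintegral_prod _ hm.aemeasurable, lintegral_bernoulliMeasure,
    lintegral_bernoulliMeasure, lintegral_bernoulliMeasure]

/-- A function of the coins that only depends on the first `j` iterations is measurable. -/
lemma measurable_of_dependsOn_past {β : Type*} [MeasurableSpace β] {j : ℕ} {f : Coins K → β}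
    (hf : ∀ x y : Coins K, (∀ i < j, x i = y i) → f x = f y) :
    ∃ φ : (Finset.range j → Fin K → Bool × Bool) → β,
      Measurable φ ∧ f = fun x => φ fun i => x i := by
  classical
  -- The filler coins from iteration `j` on never matter to `f`; the first `j` rounds form a finite
  -- space, where every function is measurable.
  refine ⟨fun z => f fun i => if h : i ∈ Finset.range j then z ⟨i, h⟩ else fun _ => (true, true),
    measurable_of_finite _, funext fun x => hf _ _ fun i hi => ?_⟩
  simp [hi]

lemma Measurable.of_dependsOn_past {β : Type*} [MeasurableSpace β] {j : ℕ} {f : Coins K → β}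
    (hf : ∀ x y : Coins K, (∀ i < j, x i = y i) → f x = f y) : Measurable f := by
  obtain ⟨φ, hφ, rfl⟩ := measurable_of_dependsOn_past hf
  exact hφ.comp (by fun_prop)

/-- The coins of iteration `j` are independent of the coins of the earlier iterations. -/
lemma lintegral_past_mul (P L : Fin K → I) {j : ℕ} {f : Coins K → ℝ≥0∞}
    (hf : ∀ x y : Coins K, (∀ i < j, x i = y i) → f x = f y)
    (g : (Fin K → Bool × Bool) → ℝ≥0∞) :
    ∫⁻ x, f x * g (x j) ∂(userLaw P L) =
      (∫⁻ x, f x ∂(userLaw P L)) * ∫⁻ y, g y ∂(roundLaw P L) := by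
  obtain ⟨φ, hφ, rfl⟩ := measurable_of_dependsOn_past hf
  have hg : Measurable g := measurable_of_finite g
  have hind : iIndepFun (fun (i : ℕ) (x : Coins K) => x i) (userLaw P L) :=
    iIndepFun_infinitePi (X := fun _ y => y) fun _ => measurable_id
  have h2 := hind.indepFun_finset (Finset.range j) {j} (by simp) (fun i => measurable_pi_apply i)
  have h3 := h2.comp hφ (hg.comp (measurable_pi_apply (⟨j, by simp⟩ : ({j} : Finset ℕ))))
  have h4 : ∫⁻ y, g y ∂(roundLaw P L) = ∫⁻ x, g (x j) ∂(userLaw P L) :=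
    ((measurePreserving_eval_infinitePi (fun _ : ℕ => roundLaw P L) j).lintegral_comp hg).symm
  rw [h4]
  exact lintegral_mul_eq_lintegral_mul_lintegral_of_indepFun
    (f := fun x : Coins K => φ fun i => x i) (g := fun x : Coins K => g (x j))
    (hφ.comp (by fun_prop)) (hg.comp (measurable_pi_apply j)) h3

/-! ### Which coins each event reads. -/

lemma history_congr (p : Policy K) {x y : Coins K} {j : ℕ} (h : ∀ i < j, x i = y i) :
    history p x j = history p y j := by
  induction j with
  | zero => rfl
  | succ j ih => simp [history, ih fun i hi => h i (by omega), h j (by omega)]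

lemma category_congr (p : Policy K) {x y : Coins K} {j : ℕ} (h : ∀ i < j, x i = y i) :
    category p x j = category p y j := by
  rw [category, category, history_congr p h]

lemma clicks_congr (p : Policy K) {x y : Coins K} {j : ℕ} (h : ∀ i < j + 1, x i = y i) :
    Clicks p x j ↔ Clicks p y j := by
  rw [Clicks, Clicks, category_congr p fun i hi => h i (by omega), h j (by omega)]

lemma departs_congr (p : Policy K) {x y : Coins K} {j : ℕ} (h : ∀ i < j + 1, x i = y i) :
    Departs p x j ↔ Departs p y j := by
  rw [Departs, Departs, clicks_congr p h, category_congr p fun i hi => h i (by omega),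
    h j (by omega)]

lemma present_congr (p : Policy K) {x y : Coins K} {j : ℕ} (h : ∀ i < j, x i = y i) :
    Present p x j ↔ Present p y j := by
  refine forall₂_congr fun i hi => ?_
  rw [departs_congr p fun k hk => h k (by omega)]

open Classical in
lemma measurable_policyReturn (p : Policy K) : Measurable (policyReturn p) := by
  refine Measurable.tsum fun j => Measurable.of_dependsOn_past (j := j + 1) fun x y h => ?_
  rw [present_congr p fun i hi => h i (by omega), clicks_congr p h]

/-! ### Occupancies and the upper bound for adaptive policies. -/

/-- The probability that the user is present in iteration `j` and is recommended `a`. -/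
noncomputable def occupancy (P L : Fin K → I) (p : Policy K) (j : ℕ) (a : Fin K) : ℝ≥0∞ :=
  userLaw P L {x | Present p x j ∧ category p x j = a}

open Classical in
/-- The expected value of a function of the coin of the recommended category, while present. -/
lemma lintegral_present_coin (P L : Fin K → I) (p : Policy K) (j : ℕ) (h : Bool × Bool → ℝ≥0∞) :
    ∫⁻ x, (if Present p x j then h (x j (category p x j)) else 0) ∂(userLaw P L) =
      ∑ a, occupancy P L p j a * ∫⁻ y, h (y a) ∂(roundLaw P L) := by
  have hdep : ∀ a, ∀ x y : Coins K, (∀ i < j, x i = y i) →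
      (if Present p x j ∧ category p x j = a then (1 : ℝ≥0∞) else 0) =
        if Present p y j ∧ category p y j = a then 1 else 0 := by
    intro a x y hxy
    rw [present_congr p hxy, category_congr p hxy]
  -- Splitting by the recommended category replaces a random coordinate by a fixed one, so each
  -- summand is a function of the past times a function of round `j`.
  have hpt : ∀ x : Coins K, (if Present p x j then h (x j (category p x j)) else 0) =
      ∑ a, (if Present p x j ∧ category p x j = a then (1 : ℝ≥0∞) else 0) * h (x j a) := by
    intro x
    by_cases hx : Present p x j <;> simp [hx]
  simp_rw [hpt]
  rw [lintegral_finsetSum]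
  swap
  · exact fun a _ => (Measurable.of_dependsOn_past (hdep a)).mul
      ((measurable_of_finite h).comp ((measurable_pi_apply a).comp (measurable_pi_apply j)))
  refine Finset.sum_congr rfl fun a _ => ?_
  rw [lintegral_past_mul P L (hdep a) fun y => h (y a)]
  congr 1
  have hm : MeasurableSet {x : Coins K | Present p x j ∧ category p x j = a} := by
    refine measurableSet_setOfPred.2 (Measurable.of_dependsOn_past (j := j) fun x y hxy => ?_)
    rw [present_congr p hxy, category_congr p hxy]
  rw [occupancy, ← lintegral_indicator_one hm]
  refine lintegral_congr fun x => ?_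
  simp [Set.indicator_apply]

lemma lintegral_roundLaw_click (P L : Fin K → I) (a : Fin K) :
    ∫⁻ y, (if (y a).1 = true then 1 else 0) ∂(roundLaw P L) = ENNReal.ofReal (P a) := by
  rw [lintegral_roundLaw P L a fun b => if b.1 = true then 1 else 0]
  simp only [if_true, mul_one, Bool.false_eq_true, if_false, mul_zero, add_zero]
  rw [← ENNReal.ofReal_add (L a).2.1 (sub_nonneg.2 (L a).2.2)]
  simp

lemma lintegral_roundLaw_leave (P L : Fin K → I) (a : Fin K) :
    ∫⁻ y, (if (y a).1 = false ∧ (y a).2 = true then 1 else 0) ∂(roundLaw P L) =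
      ENNReal.ofReal (leaveProb P L a) := by
  rw [lintegral_roundLaw P L a fun b => if b.1 = false ∧ b.2 = true then 1 else 0]
  simp only [leaveProb, ENNReal.ofReal_mul (L a).2.1]
  simp [mul_comm]

open Classical in
lemma expectedReturn_eq_tsum (P L : Fin K → I) (p : Policy K) :
    expectedReturn P L p = ∑' j, ∑ a, occupancy P L p j a * ENNReal.ofReal (P a) := by
  have hm : ∀ j, Measurable fun x : Coins K =>
      if Present p x j ∧ Clicks p x j then (1 : ℝ≥0∞) else 0 := fun j => by
    refine Measurable.of_dependsOn_past (j := j + 1) fun x y h => ?_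
    rw [present_congr p fun i hi => h i (by omega), clicks_congr p h]
  simp only [expectedReturn, policyReturn]
  rw [lintegral_tsum fun j => (hm j).aemeasurable]
  refine tsum_congr fun j => ?_
  simp_rw [← lintegral_roundLaw_click P L]
  rw [← lintegral_present_coin P L p j fun b => if b.1 = true then 1 else 0]
  refine lintegral_congr fun x => ?_
  by_cases h : Present p x j <;> simp [h, Clicks]

lemma present_departs_unique (p : Policy K) (x : Coins K) {i j : ℕ}
    (hi : Present p x i ∧ Departs p x i) (hj : Present p x j ∧ Departs p x j) : i = j := by
  rcases lt_trichotomy i j with h | h | h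
  · exact absurd hi.2 (hj.1 i h)
  · exact h
  · exact absurd hj.2 (hi.1 j h)

open Classical in
/-- The user departs at most once. -/
lemma tsum_occupancy_leaveProb_le_one (P L : Fin K → I) (p : Policy K) :
    ∑' j, ∑ a, occupancy P L p j a * ENNReal.ofReal (leaveProb P L a) ≤ 1 := by
  have hm : ∀ j, Measurable fun x : Coins K =>
      if Present p x j ∧ Departs p x j then (1 : ℝ≥0∞) else 0 := fun j => by
    refine Measurable.of_dependsOn_past (j := j + 1) fun x y h => ?_
    rw [present_congr p fun i hi => h i (by omega), departs_congr p h]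
  have key : ∀ j, ∑ a, occupancy P L p j a * ENNReal.ofReal (leaveProb P L a) =
      ∫⁻ x, (if Present p x j ∧ Departs p x j then 1 else 0) ∂(userLaw P L) := by
    intro j
    simp_rw [← lintegral_roundLaw_leave P L]
    rw [← lintegral_present_coin P L p j fun b => if b.1 = false ∧ b.2 = true then 1 else 0]
    refine lintegral_congr fun x => ?_
    by_cases h : Present p x j <;> simp [h, Departs, Clicks]
  simp_rw [key]
  rw [← lintegral_tsum fun j => (hm j).aemeasurable]
  refine (lintegral_mono (g := fun _ => 1) fun x => ?_).trans (by simp)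
  -- Pointwise, only the iteration of the departure contributes to the series.
  by_cases hx : ∃ N, Present p x N ∧ Departs p x N
  · obtain ⟨N, hN⟩ := hx
    rw [tsum_eq_single N]
    · simp [hN]
    · intro j hj
      by_contra hne
      refine hj (present_departs_unique p x ⟨?_, ?_⟩ hN) <;> · by_contra h; simp [h] at hne
  · simp only [not_exists, not_and] at hx
    rw [ENNReal.tsum_eq_zero.2]
    · exact zero_le
    · intro j
      by_cases hj : Present p x j <;> simp [hj, hx j]

/-- No policy has an expected return above the maximal ratio of the click probability and the
departure probability of a category. -/
lemma expectedReturn_le (P L : Fin K → I) {m : ℝ} (hm : 0 ≤ m)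
    (h : ∀ a, (P a : ℝ) ≤ m * leaveProb P L a) (p : Policy K) :
    expectedReturn P L p ≤ ENNReal.ofReal m := by
  calc expectedReturn P L p
      = ∑' j, ∑ a, occupancy P L p j a * ENNReal.ofReal (P a) := expectedReturn_eq_tsum P L p
    _ ≤ ∑' j, ENNReal.ofReal m *
          ∑ a, occupancy P L p j a * ENNReal.ofReal (leaveProb P L a) := by
        refine ENNReal.tsum_le_tsum fun j => ?_
        rw [Finset.mul_sum]
        refine Finset.sum_le_sum fun a _ => ?_
        rw [mul_left_comm, ← ENNReal.ofReal_mul hm]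
        gcongr
        exact h a
    _ ≤ ENNReal.ofReal m * 1 := by
        rw [ENNReal.tsum_mul_left]
        gcongr
        exact tsum_occupancy_leaveProb_le_one P L p
    _ = ENNReal.ofReal m := mul_one _

/-! ### Mean and generating function of a fixed-arm return. -/

/-- The weight `w` of a click, weight `1` for staying without a click, weight `0` for leaving. -/
noncomputable def stayWeight (w : ℝ) (b : Bool × Bool) : ℝ :=
  if b.1 = true then w else if b.2 = true then 0 else 1

lemma stayWeight_nonneg {w : ℝ} (hw : 0 ≤ w) (b : Bool × Bool) : 0 ≤ stayWeight w b := by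
  unfold stayWeight; split_ifs <;> simp [hw]

lemma lintegral_roundLaw_stayWeight (P L : Fin K → I) (a : Fin K) {w : ℝ} (hw : 0 ≤ w) :
    ∫⁻ y, ENNReal.ofReal (stayWeight w (y a)) ∂(roundLaw P L) =
      ENNReal.ofReal (P a * w + (1 - P a - leaveProb P L a)) := by
  have h1 : 0 ≤ 1 - (P a : ℝ) := sub_nonneg.2 (P a).2.2
  have h2 : 0 ≤ 1 - (L a : ℝ) := sub_nonneg.2 (L a).2.2
  have h3 := (P a).2.1
  have h4 := (L a).2.1
  rw [lintegral_roundLaw P L a fun b => ENNReal.ofReal (stayWeight w b)]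
  simp only [stayWeight, if_true, Bool.false_eq_true, if_false, ENNReal.ofReal_zero, mul_zero,
    zero_add, ENNReal.ofReal_one, mul_one]
  rw [← add_mul, ← ENNReal.ofReal_add h4 h2, ← ENNReal.ofReal_mul (by positivity),
    ← ENNReal.ofReal_mul h3, ← ENNReal.ofReal_mul h1, ← ENNReal.ofReal_add (by positivity)
    (by positivity)]
  congr 1
  unfold leaveProb
  ring

/-- The product is `w` to the number of clicks as long as the user is present and vanishes after her
departure. The rounds are i.i.d., so its mean is a power. -/
lemma lintegral_prod_stayWeight (P L : Fin K → I) (a : Fin K) {w : ℝ} (hw : 0 ≤ w) (j : ℕ) :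
    ∫⁻ x : Coins K, ENNReal.ofReal (∏ i ∈ Finset.range j, stayWeight w (x i a)) ∂(userLaw P L) =
      ENNReal.ofReal (P a * w + (1 - P a - leaveProb P L a)) ^ j := by
  induction j with
  | zero => simp
  | succ j ih =>
    rw [pow_succ, ← ih, ← lintegral_roundLaw_stayWeight P L a hw, ← lintegral_past_mul P L]
    · refine lintegral_congr fun x => ?_
      rw [Finset.prod_range_succ,
        ENNReal.ofReal_mul (Finset.prod_nonneg fun i _ => stayWeight_nonneg hw _)]
    · intro x y h
      rw [Finset.prod_congr rfl fun i hi => by rw [h i (Finset.mem_range.1 hi)]]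

lemma departs_fixedArm (a : Fin K) (x : Coins K) (j : ℕ) :
    Departs (fixedArm a) x j ↔ (x j a).1 = false ∧ (x j a).2 = true := by
  simp [Departs, Clicks, category, fixedArm]

-- Setting `w = 1` turns the generating function into survival probabilities.
open Classical in
lemma prod_stayWeight_one (a : Fin K) (x : Coins K) (j : ℕ) :
    ∏ i ∈ Finset.range j, stayWeight 1 (x i a) = if Present (fixedArm a) x j then 1 else 0 := by
  split_ifs with h
  · refine Finset.prod_eq_one fun i hi => ?_
    have := h i (Finset.mem_range.1 hi)
    rw [departs_fixedArm] at this
    unfold stayWeight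
    split_ifs <;> simp_all
  · simp only [Present, not_forall, not_not] at h
    obtain ⟨i, hi, h⟩ := h
    rw [departs_fixedArm] at h
    exact Finset.prod_eq_zero (Finset.mem_range.2 hi) (by simp [stayWeight, h.1, h.2])

lemma leaveProb_le (P L : Fin K → I) (a : Fin K) : leaveProb P L a ≤ 1 - P a := by
  have := mul_le_mul_of_nonneg_right (L a).2.2 (sub_nonneg.2 (P a).2.2)
  rw [one_mul] at this
  exact this

lemma leaveProb_nonneg (P L : Fin K → I) (a : Fin K) : 0 ≤ leaveProb P L a :=
  mul_nonneg (L a).2.1 (sub_nonneg.2 (P a).2.2)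

lemma measurableSet_present (p : Policy K) (j : ℕ) : MeasurableSet {x : Coins K | Present p x j} := by
  refine measurableSet_setOfPred.2 (Measurable.of_dependsOn_past (j := j) fun x y hxy => ?_)
  rw [present_congr p hxy]

open Classical in
lemma userLaw_present_fixedArm (P L : Fin K → I) (a : Fin K) (j : ℕ) :
    userLaw P L {x | Present (fixedArm a) x j} = ENNReal.ofReal (1 - leaveProb P L a) ^ j := by
  rw [← lintegral_indicator_one (measurableSet_present _ j)]
  have h := lintegral_prod_stayWeight P L a zero_le_one j
  rw [show (P a : ℝ) * 1 + (1 - P a - leaveProb P L a) = 1 - leaveProb P L a by ring] at h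
  rw [← h]
  refine lintegral_congr fun x => ?_
  rw [prod_stayWeight_one]
  by_cases hx : Present (fixedArm a) x j <;> simp [hx]

lemma tsum_geometric_ofReal {q : ℝ} (hq0 : 0 ≤ q) (hq1 : q < 1) :
    ∑' j, ENNReal.ofReal q ^ j = ENNReal.ofReal (1 / (1 - q)) := by
  rw [ENNReal.tsum_geometric, ← ENNReal.ofReal_one, ← ENNReal.ofReal_sub _ hq0,
    ← ENNReal.ofReal_inv_of_pos (by linarith), one_div]

/-- The expected return of the fixed-arm policy. -/
lemma expectedReturn_fixedArm (P L : Fin K → I) (a : Fin K) (h : 0 < leaveProb P L a) :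
    expectedReturn P L (fixedArm a) = ENNReal.ofReal (P a / leaveProb P L a) := by
  have h1 := leaveProb_le P L a
  have h2 := (P a).2.1
  have hocc : ∀ j b, occupancy P L (fixedArm a) j b =
      if b = a then ENNReal.ofReal (1 - leaveProb P L a) ^ j else 0 := by
    intro j b
    rw [← userLaw_present_fixedArm, occupancy]
    split_ifs with hb
    · simp [category, fixedArm, hb]
    · simp [category, fixedArm, Ne.symm hb]
  rw [expectedReturn_eq_tsum]
  simp only [hocc, ite_mul, zero_mul, Finset.sum_ite_eq', Finset.mem_univ, if_true]
  rw [ENNReal.tsum_mul_right, tsum_geometric_ofReal (by linarith) (by linarith),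
    ← ENNReal.ofReal_mul (by rw [sub_sub_cancel]; positivity), sub_sub_cancel, one_div,
    inv_mul_eq_div]

/-- With a positive departure probability, the user departs almost surely. -/
lemma ae_exists_departs (P L : Fin K → I) (a : Fin K) (h : 0 < leaveProb P L a) :
    ∀ᵐ x ∂(userLaw P L), ∃ N, Present (fixedArm a) x N ∧ Departs (fixedArm a) x N := by
  classical
  have h0 : userLaw P L {x | ∀ j, ¬ Departs (fixedArm a) x j} = 0 := by
    have hlt : ENNReal.ofReal (1 - leaveProb P L a) < 1 := by
      rw [ENNReal.ofReal_lt_one]; linarith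
    -- Never departing implies being present in iteration `j`, for every `j`, and those
    -- probabilities decay geometrically.
    refine le_antisymm (ge_of_tendsto' (ENNReal.tendsto_pow_atTop_nhds_zero_of_lt_one hlt)
      fun j => ?_) zero_le
    rw [← userLaw_present_fixedArm]
    exact measure_mono fun x hx i _ => hx i
  filter_upwards [compl_mem_ae_iff.2 h0] with x hx
  simp only [Set.mem_compl_iff, Set.mem_ofPred_eq, not_forall, not_not] at hx
  exact ⟨Nat.find hx, fun i hi => Nat.find_min hx hi, Nat.find_spec hx⟩

open Classical in
lemma policyReturn_of_departs (p : Policy K) (x : Coins K) {N : ℕ} (hN : Present p x N)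
    (hd : Departs p x N) :
    (policyReturn p x).toReal = ∑ i ∈ Finset.range N, if Clicks p x i then (1 : ℝ) else 0 := by
  have hz : ∀ j ∉ Finset.range N, (if Present p x j ∧ Clicks p x j then (1 : ℝ≥0∞) else 0) = 0 := by
    intro j hj
    simp only [Finset.mem_range, not_lt] at hj
    refine if_neg fun hjj => ?_
    rcases hj.eq_or_lt with rfl | hlt
    · exact hd.1 hjj.2
    · exact hjj.1 N hlt hd
  rw [policyReturn, tsum_eq_sum hz, ENNReal.toReal_sum fun i _ => by split_ifs <;> simp]
  refine Finset.sum_congr rfl fun i hi => ?_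
  have : Present p x i := fun k hk => hN k (hk.trans (Finset.mem_range.1 hi))
  by_cases hc : Clicks p x i <;> simp [this, hc]

/-- Decomposition by the time of departure. Before `N` no departure coin fires, and after `N` the
product contains the zero weight of round `N`, so only the term `N` survives. -/
lemma exp_policyReturn_eq_tsum (a : Fin K) (x : Coins K) {N : ℕ}
    (hN : Present (fixedArm a) x N) (hd : Departs (fixedArm a) x N) (γ : ℝ) :
    ENNReal.ofReal (Real.exp (γ * (policyReturn (fixedArm a) x).toReal)) =
      ∑' j, ENNReal.ofReal (∏ i ∈ Finset.range j, stayWeight (Real.exp γ) (x i a)) *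
        (if (x j a).1 = false ∧ (x j a).2 = true then 1 else 0) := by
  classical
  rw [tsum_eq_single N, if_pos ((departs_fixedArm a x N).1 hd), mul_one,
    policyReturn_of_departs _ x hN hd, Finset.mul_sum, Real.exp_sum]
  · refine congrArg _ (Finset.prod_congr rfl fun i hi => ?_)
    have := hN i (Finset.mem_range.1 hi)
    rw [departs_fixedArm] at this
    simp only [stayWeight, Clicks, category, fixedArm]
    split_ifs <;> simp_all
  · intro j hj
    by_cases h : (x j a).1 = false ∧ (x j a).2 = true
    · have hNj : N < j := by
        refine lt_of_le_of_ne (not_lt.1 fun hlt => ?_) hj.symm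
        exact hN j hlt ((departs_fixedArm a x j).2 h)
      rw [departs_fixedArm] at hd
      rw [Finset.prod_eq_zero (Finset.mem_range.2 hNj) (by simp [stayWeight, hd.1, hd.2])]
      simp
    · rw [if_neg h, mul_zero]

/-- The moment generating function of the return of a fixed-arm policy. -/
lemma lintegral_exp_policyReturn (P L : Fin K → I) (a : Fin K) (h : 0 < leaveProb P L a) {γ : ℝ}
    (hγ : P a / leaveProb P L a * (Real.exp γ - 1) < 1) :
    ∫⁻ x, ENNReal.ofReal (Real.exp (γ * (policyReturn (fixedArm a) x).toReal)) ∂(userLaw P L) =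
      ENNReal.ofReal (1 / (1 - P a / leaveProb P L a * (Real.exp γ - 1))) := by
  have h1 := leaveProb_le P L a
  have h2 := (P a).2.1
  set d := leaveProb P L a with hdd
  set q : ℝ := P a * Real.exp γ + (1 - P a - d) with hq
  have hq0 : 0 ≤ q := add_nonneg (mul_nonneg h2 (Real.exp_pos _).le) (by linarith)
  -- The series over departure times is geometric with ratio `q`; this identity makes `hγ` its
  -- convergence condition.
  have hq' : 1 - q = d * (1 - P a / d * (Real.exp γ - 1)) := by rw [hq]; field_simp; ring
  have hq1 : 0 < 1 - q := by rw [hq']; exact mul_pos h (by linarith)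
  have hw : 0 ≤ Real.exp γ := (Real.exp_pos _).le
  have hdep : ∀ j, ∀ x y : Coins K, (∀ i < j, x i = y i) →
      ENNReal.ofReal (∏ i ∈ Finset.range j, stayWeight (Real.exp γ) (x i a)) =
        ENNReal.ofReal (∏ i ∈ Finset.range j, stayWeight (Real.exp γ) (y i a)) := by
    intro j x y hxy
    rw [Finset.prod_congr rfl fun i hi => by rw [hxy i (Finset.mem_range.1 hi)]]
  have hae := ae_exists_departs P L a h
  calc _ = ∫⁻ x, ∑' j, ENNReal.ofReal
            (∏ i ∈ Finset.range j, stayWeight (Real.exp γ) (x i a)) *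
          (if (x j a).1 = false ∧ (x j a).2 = true then 1 else 0) ∂(userLaw P L) := by
        refine lintegral_congr_ae ?_
        filter_upwards [hae] with x hx
        obtain ⟨N, hN, hd⟩ := hx
        exact exp_policyReturn_eq_tsum a x hN hd γ
    _ = ∑' j, ENNReal.ofReal q ^ j * ENNReal.ofReal d := by
        rw [lintegral_tsum]
        · refine tsum_congr fun j => ?_
          rw [lintegral_past_mul P L (hdep j) fun y =>
            if (y a).1 = false ∧ (y a).2 = true then 1 else 0, lintegral_roundLaw_leave,
            lintegral_prod_stayWeight P L a hw]
        · intro j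
          refine ((Measurable.of_dependsOn_past (hdep j)).mul ?_).aemeasurable
          exact (measurable_of_finite fun y : Fin K → Bool × Bool =>
            if (y a).1 = false ∧ (y a).2 = true then (1 : ℝ≥0∞) else 0).comp
              (measurable_pi_apply j)
    _ = _ := by
        rw [ENNReal.tsum_mul_right, tsum_geometric_ofReal hq0 (by linarith),
          ← ENNReal.ofReal_mul (by positivity), hq']
        congr 1
        have : 1 - P a / d * (Real.exp γ - 1) ≠ 0 := by linarith
        field_simp

/-! ### Geometric variables are sub-exponential. -/

lemma exp_sub_one_bounds (γ : ℝ) :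
    |Real.exp γ - 1| ≤ |γ| * Real.exp |γ| ∧ Real.exp γ - 1 - γ ≤ γ ^ 2 * Real.exp |γ| := by
  have h1 := Real.add_one_le_exp γ
  have h2 : Real.exp γ - 1 ≤ γ * Real.exp γ := by
    have := mul_le_mul_of_nonneg_left (Real.add_one_le_exp (-γ)) (Real.exp_pos γ).le
    rw [← Real.exp_add] at this
    simp at this
    linarith
  rcases le_total 0 γ with h | h
  · rw [abs_of_nonneg h, abs_of_nonneg (by linarith)]
    refine ⟨h2, ?_⟩
    nlinarith [mul_le_mul_of_nonneg_left h2 h]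
  · have h3 : (1 : ℝ) ≤ Real.exp |γ| := Real.one_le_exp (abs_nonneg _)
    have h4 : Real.exp γ ≤ 1 := Real.exp_le_one_iff.2 h
    rw [abs_of_nonpos (by linarith : Real.exp γ - 1 ≤ 0)]
    refine ⟨?_, ?_⟩
    · nlinarith [abs_of_nonpos h, mul_le_mul_of_nonneg_left h3 (abs_nonneg γ)]
    · nlinarith [mul_le_mul_of_nonneg_left h3 (sq_nonneg γ)]

/-- For `u ≤ 0` the linear bound on `exp` suffices, since `(1 + u + u²)(1 - u) = 1 - u³`; for `u ≥
0` the quadratic one is needed. -/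
lemma one_div_one_sub_le_exp {u : ℝ} (hu : |u| ≤ 1 / 3) : 1 / (1 - u) ≤ Real.exp (u + u ^ 2) := by
  obtain ⟨h1, h2⟩ := abs_le.1 hu
  rw [div_le_iff₀ (by linarith)]
  rcases le_total 0 u with h | h
  · have h3 := Real.quadratic_le_exp_of_nonneg (by positivity : 0 ≤ u + u ^ 2)
    nlinarith [mul_le_mul_of_nonneg_right h3 (by linarith : 0 ≤ 1 - u), pow_nonneg h 3,
      pow_nonneg h 4, mul_nonneg (sq_nonneg u) (by linarith : 0 ≤ 1 - 3 * u), sq_nonneg u,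
      mul_nonneg (pow_nonneg h 4) (by linarith : 0 ≤ 1 - u), mul_nonneg (pow_nonneg h 3) (by linarith : 0 ≤ 1 - u)]
  · have h3 := Real.add_one_le_exp (u + u ^ 2)
    have h4 : 0 ≤ (-u) ^ 3 := pow_nonneg (by linarith) 3
    nlinarith [mul_le_mul_of_nonneg_right h3 (by linarith : 0 ≤ 1 - u)]

/-- A geometric variable of mean `m ≤ 1 / (e ^ l - 1)` is sub-exponential with both parameters
equal to `8 e / l`. -/
lemma geometric_subexponential {l m γ τ : ℝ} (hl : 0 < l) (hm0 : 0 ≤ m)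
    (hm : m ≤ 1 / (Real.exp l - 1)) (hτ : τ = 8 * Real.exp 1 / l) (hγ : |γ| ≤ 1 / τ) :
    m * (Real.exp γ - 1) < 1 ∧
      1 / (1 - m * (Real.exp γ - 1)) ≤ Real.exp (γ * m + γ ^ 2 * τ ^ 2 / 2) := by
  have he : 2 ≤ Real.exp 1 := by have := Real.add_one_le_exp (1 : ℝ); linarith
  have hγ1 : |γ| ≤ l / 16 := by
    refine hγ.trans ?_
    rw [hτ, one_div_div]
    gcongr
    linarith
  -- This is `sinh (l/2) ≥ l/2`. The factor `exp (l/2)` absorbs `exp |γ|` and still leaves a decay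
  -- of `exp (-l/4)`, needed to get `4 / l ^ 2` for large `l` too.
  have hsinh : l * Real.exp (l / 2) ≤ Real.exp l - 1 := by
    have h1 := Real.self_le_sinh_iff.2 (by positivity : 0 ≤ l / 2)
    rw [Real.sinh_eq] at h1
    have h2 : Real.exp l = Real.exp (l / 2) * Real.exp (l / 2) := by
      rw [← Real.exp_add]; congr 1; ring
    have h3 : Real.exp (l / 2) * Real.exp (-(l / 2)) = 1 := by rw [← Real.exp_add]; simp
    have h4 := Real.exp_pos (l / 2)
    nlinarith [mul_le_mul_of_nonneg_left h1 h4.le]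
  have hM : m * Real.exp |γ| ≤ Real.exp (-(l / 4)) / l := by
    calc m * Real.exp |γ| ≤ 1 / (l * Real.exp (l / 2)) * Real.exp (l / 4) := by
          gcongr
          · exact hm.trans (by gcongr)
          · linarith
      _ = Real.exp (-(l / 4)) / l := by
          rw [show l / 2 = l / 4 + l / 4 by ring, Real.exp_add, Real.exp_neg]
          field_simp
  have hM1 : m * Real.exp |γ| ≤ 1 / l :=
    hM.trans (by gcongr; exact Real.exp_le_one_iff.2 (by linarith))
  have hM2 : m * Real.exp |γ| ≤ 4 / l ^ 2 := by
    refine hM.trans ?_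
    have h1 : l / 4 ≤ Real.exp (l / 4) := by linarith [Real.add_one_le_exp (l / 4)]
    rw [Real.exp_neg, ← one_div, div_div, div_le_div_iff₀ (by positivity) (by positivity)]
    nlinarith
  obtain ⟨hb1, hb2⟩ := exp_sub_one_bounds γ
  set u := m * (Real.exp γ - 1) with hu
  have hu1 : |u| ≤ |γ| / l := by
    rw [hu, abs_mul, abs_of_nonneg hm0]
    calc m * |Real.exp γ - 1| ≤ m * (|γ| * Real.exp |γ|) := by gcongr
      _ = |γ| * (m * Real.exp |γ|) := by ring
      _ ≤ |γ| * (1 / l) := by gcongr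
      _ = |γ| / l := by ring
  have hu2 : |u| ≤ 1 / 3 := hu1.trans (by rw [div_le_iff₀ hl]; linarith)
  refine ⟨by linarith [le_abs_self u], (one_div_one_sub_le_exp hu2).trans (Real.exp_le_exp.2 ?_)⟩
  have h5 : u ^ 2 ≤ γ ^ 2 / l ^ 2 := by
    rw [← sq_abs u, ← sq_abs γ, ← div_pow]
    gcongr
  have h6 : u - γ * m ≤ γ ^ 2 * (4 / l ^ 2) := by
    calc u - γ * m = m * (Real.exp γ - 1 - γ) := by rw [hu]; ring
      _ ≤ m * (γ ^ 2 * Real.exp |γ|) := by gcongr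
      _ = γ ^ 2 * (m * Real.exp |γ|) := by ring
      _ ≤ γ ^ 2 * (4 / l ^ 2) := by gcongr
  -- The `5` is `1` from `u ^ 2` plus `4` from the second-order remainder of `exp`.
  have h7 : γ ^ 2 * 5 / l ^ 2 ≤ γ ^ 2 * τ ^ 2 / 2 := by
    rw [show γ ^ 2 * τ ^ 2 / 2 = γ ^ 2 * (32 * Real.exp 1 ^ 2) / l ^ 2 by
      rw [hτ]; field_simp; ring]
    gcongr
    nlinarith
  have h8 : γ ^ 2 * 5 / l ^ 2 = γ ^ 2 / l ^ 2 + γ ^ 2 * (4 / l ^ 2) := by ring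
  linarith

/-! ### Centred returns of the arms. -/

/-- The expected return of a fixed-arm policy. -/
noncomputable def armMean (P L : Fin K → I) (a : Fin K) : ℝ := P a / leaveProb P L a

lemma armMean_nonneg (P L : Fin K → I) (a : Fin K) : 0 ≤ armMean P L a :=
  div_nonneg (P a).2.1 (leaveProb_nonneg P L a)

lemma armMean_le {ε : ℝ} (hε : 0 < ε) (P L : Fin K → I) (a : Fin K) (h : ε ≤ leaveProb P L a) :
    armMean P L a ≤ (1 - ε) / ε := by
  have h1 := leaveProb_le P L a
  have h2 := (P a).2.1
  unfold armMean
  gcongr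
  · linarith
  · linarith

lemma measurable_return_toReal (p : Policy K) :
    Measurable fun x : Coins K => (policyReturn p x).toReal :=
  (measurable_policyReturn p).ennreal_toReal

lemma integrable_return_fixedArm (P L : Fin K → I) (a : Fin K) (h : 0 < leaveProb P L a) :
    Integrable (fun x => (policyReturn (fixedArm a) x).toReal) (userLaw P L) := by
  refine integrable_toReal_of_lintegral_ne_top (measurable_policyReturn _).aemeasurable ?_
  have := expectedReturn_fixedArm P L a h
  rw [expectedReturn] at this
  rw [this]
  exact ENNReal.ofReal_ne_top

lemma integral_return_fixedArm (P L : Fin K → I) (a : Fin K) (h : 0 < leaveProb P L a) :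
    ∫ x, (policyReturn (fixedArm a) x).toReal ∂(userLaw P L) = armMean P L a := by
  have h1 := expectedReturn_fixedArm P L a h
  rw [expectedReturn] at h1
  rw [integral_toReal (measurable_policyReturn _).aemeasurable
    (ae_lt_top (measurable_policyReturn _) (by rw [h1]; exact ENNReal.ofReal_ne_top)), h1]
  exact ENNReal.toReal_ofReal (armMean_nonneg P L a)

/-- The centred return of a fixed-arm policy is sub-exponential. -/
lemma lintegral_exp_return_le_one {ε τ : ℝ} (hε0 : 0 < ε) (hε1 : ε < 1)
    (hτ : τ = 8 * Real.exp 1 / Real.log (1 / (1 - ε))) (P L : Fin K → I) (a : Fin K)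
    (h : ε ≤ leaveProb P L a) {γ : ℝ} (hγ : |γ| ≤ 1 / τ) :
    ∫⁻ x, ENNReal.ofReal (Real.exp (γ * ((policyReturn (fixedArm a) x).toReal - armMean P L a)
      - γ ^ 2 * τ ^ 2 / 2)) ∂(userLaw P L) ≤ 1 := by
  have hl : 0 < Real.log (1 / (1 - ε)) :=
    Real.log_pos (by rw [one_div]; exact (one_lt_inv₀ (by linarith)).2 (by linarith))
  -- With `l = log (1 / (1 - ε))`, the bound `(1 - ε) / ε` on the mean is exactly `1 / (e ^ l - 1)`.
  have hm : armMean P L a ≤ 1 / (Real.exp (Real.log (1 / (1 - ε))) - 1) := by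
    refine (armMean_le hε0 P L a h).trans_eq ?_
    have : 1 - ε ≠ 0 := by linarith
    rw [Real.exp_log (by rw [one_div]; exact inv_pos.2 (by linarith))]
    rw [show 1 / (1 - ε) - 1 = ε / (1 - ε) by field_simp; ring, one_div_div]
  obtain ⟨h1, h2⟩ := geometric_subexponential hl (armMean_nonneg P L a) hm hτ hγ
  have h3 := lintegral_exp_policyReturn P L a (hε0.trans_le h) (γ := γ) h1
  set b := γ * armMean P L a + γ ^ 2 * τ ^ 2 / 2 with hb
  calc _ = ∫⁻ x, ENNReal.ofReal (Real.exp (-b)) *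
          ENNReal.ofReal (Real.exp (γ * (policyReturn (fixedArm a) x).toReal))
          ∂(userLaw P L) := by
        refine lintegral_congr fun x => ?_
        rw [← ENNReal.ofReal_mul (Real.exp_pos _).le, ← Real.exp_add]
        congr 2
        rw [hb]
        ring
    _ ≤ ENNReal.ofReal (Real.exp (-b)) * ENNReal.ofReal (Real.exp b) := by
        rw [lintegral_const_mul _ ((measurable_return_toReal _).const_mul γ).exp.ennreal_ofReal, h3]
        gcongr
        exact h2
    _ = 1 := by
        rw [← ENNReal.ofReal_mul (Real.exp_pos _).le, ← Real.exp_add]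
        simp

/-! ### The hybrid confidence radius. -/

/-- The confidence radius of UCB-Hybrid for `η = 1`. -/
noncomputable def radius (T : ℕ) (τ : ℝ) (n : ℕ) : ℝ :=
  if (n : ℝ) < 8 * Real.log T then 8 * τ * Real.log T / n else √(8 * τ ^ 2 * Real.log T / n)

lemma ucbIndex_one (T : ℕ) (τ S : ℝ) {n : ℕ} (hn : n ≠ 0) :
    ucbIndex T τ 1 n S = ((S / n + radius T τ n : ℝ) : EReal) := by
  unfold ucbIndex radius
  simp only [hn, if_false, mul_one, Real.sqrt_one]
  split_ifs <;> rfl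

/-- The parameter that optimizes the exponential tail bound at the confidence radius. -/
lemma exists_tilt {T : ℕ} {τ : ℝ} (hτ : 0 < τ) (hT : 0 < Real.log T) {n : ℕ} (hn : n ≠ 0) :
    ∃ γ, 0 ≤ γ ∧ γ ≤ 1 / τ ∧
      4 * Real.log T ≤ γ * (n * radius T τ n) - n * (γ ^ 2 * τ ^ 2 / 2) := by
  have hn' : (0 : ℝ) < n := by positivity
  -- With the square-root radius the optimal tilt is `radius / τ ^ 2`, which is at most `1 / τ` only
  -- for `n ≥ 8 log T`. Below that the endpoint `1 / τ` is used, giving `8 log T - n / 2 > 4 log T`.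
  by_cases h : (n : ℝ) < 8 * Real.log T
  · refine ⟨1 / τ, by positivity, le_rfl, ?_⟩
    rw [radius, if_pos h]
    field_simp
    linarith
  · have hs : √(8 * Real.log T / n) ^ 2 = 8 * Real.log T / n := Real.sq_sqrt (by positivity)
    refine ⟨√(8 * Real.log T / n) / τ, by positivity, ?_, ?_⟩
    · gcongr
      rw [Real.sqrt_le_one, div_le_one hn']
      linarith
    · rw [radius, if_neg h, show 8 * τ ^ 2 * Real.log T / n = τ ^ 2 * (8 * Real.log T / n) by ring,
        Real.sqrt_mul (by positivity), Real.sqrt_sq hτ.le, div_pow, hs]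
      rw [show √(8 * Real.log T / n) / τ * (n * (τ * √(8 * Real.log T / n))) =
        n * (√(8 * Real.log T / n) ^ 2) by field_simp, hs]
      field_simp
      linarith

/-! ### Pathwise counting along a run. -/

section Combinatorics

variable {ι : Type*} [DecidableEq ι]

lemma count_succ (c : ℕ → ι) (t : ℕ) (i : ι) :
    count c (t + 1) i = count c t i + if c t = i then 1 else 0 := by
  unfold count
  rw [Finset.range_add_one, Finset.filter_insert]
  split_ifs <;> simp

lemma count_le (c : ℕ → ι) (t : ℕ) (i : ι) : count c t i ≤ t :=
  (Finset.card_filter_le _ _).trans (Finset.card_range t).le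

lemma sum_count [Fintype ι] (c : ℕ → ι) (t : ℕ) : ∑ i, count c t i = t := by
  unfold count
  rw [← Finset.card_eq_sum_card_fiberwise (t := Finset.univ) fun x _ => Finset.mem_coe.2 (Finset.mem_univ (c x)),
    Finset.card_range]

/-- Regrouping by arm: at its successive executions, an arm sees its own count run through `0, 1, 2,
…`. -/
lemma sum_count_choice [Fintype ι] (c : ℕ → ι) (g : ℕ → ℝ) (t : ℕ) :
    ∑ s ∈ Finset.range t, g (count c s (c s)) = ∑ i, ∑ k ∈ Finset.range (count c t i), g k := by
  induction t with
  | zero => simp [count]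
  | succ t ih =>
    rw [Finset.sum_range_succ, ih]
    have h : ∀ i, ∑ k ∈ Finset.range (count c (t + 1) i), g k =
        ∑ k ∈ Finset.range (count c t i), g k + if c t = i then g (count c t i) else 0 := by
      intro i
      rw [count_succ]
      split_ifs
      · rw [Finset.sum_range_succ]
      · simp
    simp_rw [h, Finset.sum_add_distrib]
    simp

lemma sum_inv_sqrt_le (N : ℕ) : ∑ k ∈ Finset.range N, 1 / √(k : ℝ) ≤ 2 * √(N : ℝ) := by
  -- The term `k = 0` is `1 / 0 = 0`, so the range may be extended by one; the rest telescopes.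
  have key : ∀ N : ℕ, ∑ k ∈ Finset.range (N + 1), 1 / √(k : ℝ) ≤ 2 * √(N : ℝ) := by
    intro N
    induction N with
    | zero => simp
    | succ N ih =>
      rw [Finset.sum_range_succ]
      have ha : 0 < √((N + 1 : ℕ) : ℝ) := Real.sqrt_pos.2 (by positivity)
      have ha2 : √((N + 1 : ℕ) : ℝ) ^ 2 = N + 1 := by rw [Real.sq_sqrt (by positivity)]; simp
      have hb2 : √(N : ℝ) ^ 2 = N := Real.sq_sqrt (by positivity)
      have : 1 / √((N + 1 : ℕ) : ℝ) ≤ 2 * (√((N + 1 : ℕ) : ℝ) - √(N : ℝ)) := by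
        rw [div_le_iff₀ ha]
        nlinarith [sq_nonneg (√((N + 1 : ℕ) : ℝ) - √(N : ℝ))]
      linarith
  rcases N with _ | N
  · simp
  · refine (key N).trans ?_
    gcongr
    simp

lemma card_filter_lt_le {y : ℝ} (hy : 0 ≤ y) (N : ℕ) :
    (((Finset.range N).filter fun k : ℕ => (k : ℝ) < y).card : ℝ) ≤ y + 1 := by
  have h : ((Finset.range N).filter fun k : ℕ => (k : ℝ) < y) ⊆ Finset.range ⌈y⌉₊ := by
    intro k hk
    exact Finset.mem_range.2 (Nat.lt_ceil.2 (Finset.mem_filter.1 hk).2)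
  have h2 := Finset.card_le_card h
  rw [Finset.card_range] at h2
  exact (Nat.cast_le.2 h2).trans (Nat.ceil_lt_add_one hy).le

/-- The bound on the gap of an arm that has been chosen after `n` executions. -/
noncomputable def gapBound (T : ℕ) (τ D : ℝ) (n : ℕ) : ℝ :=
  if (n : ℝ) < 8 * Real.log T then D else 2 * √(8 * τ ^ 2 * Real.log T / n)

lemma sum_gapBound_le (T : ℕ) {τ D : ℝ} (hD : 0 ≤ D) (hT : 0 < Real.log T) (N : ℕ) :
    ∑ k ∈ Finset.range N, gapBound T τ D k ≤
      D * (8 * Real.log T + 1) + 4 * √(8 * τ ^ 2 * Real.log T) * √(N : ℝ) := by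
  have h1 : ∀ k : ℕ, gapBound T τ D k ≤ (if (k : ℝ) < 8 * Real.log T then D else 0) +
      2 * √(8 * τ ^ 2 * Real.log T) * (1 / √(k : ℝ)) := by
    intro k
    unfold gapBound
    split_ifs
    · have : 0 ≤ 2 * √(8 * τ ^ 2 * Real.log T) * (1 / √(k : ℝ)) := by positivity
      linarith
    · rw [Real.sqrt_div' _ (by positivity)]
      apply le_of_eq
      ring
  refine (Finset.sum_le_sum fun k _ => h1 k).trans ?_
  rw [Finset.sum_add_distrib, ← Finset.mul_sum, ← Finset.sum_filter, Finset.sum_const,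
    nsmul_eq_mul, mul_comm _ D]
  have h2 := mul_le_mul_of_nonneg_left (card_filter_lt_le (by positivity : 0 ≤ 8 * Real.log T) N) hD
  have h3 := mul_le_mul_of_nonneg_left (sum_inv_sqrt_le N)
    (by positivity : 0 ≤ 2 * √(8 * τ ^ 2 * Real.log T))
  linarith

/-- Cauchy–Schwarz, as the counts add up to `T`. -/
lemma sum_sqrt_count_le [Fintype ι] (c : ℕ → ι) (T : ℕ) :
    ∑ i, √(count c T i : ℝ) ≤ √(Fintype.card ι * T) := by
  refine Real.le_sqrt_of_sq_le ?_
  have h := sq_sum_le_card_mul_sum_sq (s := (Finset.univ : Finset ι))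
    (f := fun i => √(count c T i : ℝ))
  simp_rw [Real.sq_sqrt (Nat.cast_nonneg _)] at h
  rwa [← Nat.cast_sum, sum_count, Finset.card_univ] at h

lemma sum_gapBound_choice_le [Fintype ι] (c : ℕ → ι) (T : ℕ) {τ D : ℝ} (hD : 0 ≤ D)
    (hT : 0 < Real.log T) :
    ∑ t ∈ Finset.range T, gapBound T τ D (count c t (c t)) ≤
      Fintype.card ι * (D * (8 * Real.log T + 1)) +
        4 * √(8 * τ ^ 2 * Real.log T) * √(Fintype.card ι * T) := by
  rw [sum_count_choice]
  refine (Finset.sum_le_sum fun i _ => sum_gapBound_le T hD hT _).trans ?_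
  rw [Finset.sum_add_distrib, Finset.sum_const, nsmul_eq_mul, Finset.card_univ, ← Finset.mul_sum]
  have := sum_sqrt_count_le c T
  gcongr

/-- If all the confidence bounds hold, the gap of the chosen arm is small. -/
lemma gap_le_gapBound {T : ℕ} {τ D : ℝ} {m : ι → ℝ} (hm0 : ∀ i, 0 ≤ m i) (hmD : ∀ i, m i ≤ D)
    {c : ℕ → ι} {v : ℕ → ℝ} {t : ℕ} (hT : 0 < Real.log T)
    (hmax : ∀ i, ucbIndex T τ 1 (count c t i) (total c v t i) ≤
      ucbIndex T τ 1 (count c t (c t)) (total c v t (c t)))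
    (hgood : ∀ i, count c t i ≠ 0 →
      |total c v t i - count c t i * m i| ≤ count c t i * radius T τ (count c t i)) (i : ι) :
    m i - m (c t) ≤ gapBound T τ D (count c t (c t)) := by
  unfold gapBound
  split_ifs with h
  · linarith [hm0 (c t), hmD i]
  · have hn : count c t (c t) ≠ 0 := by
      rintro h0
      rw [h0] at h
      simp at h
      linarith
    have h1 := hmax i
    rw [ucbIndex_one _ _ _ hn] at h1
    -- An arm not yet executed has index `⊤`, which the real index of the chosen arm could not
    -- match.
    have hi : count c t i ≠ 0 := by
      intro h0
      rw [ucbIndex, if_pos h0, top_le_iff] at h1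
      exact EReal.coe_ne_top _ h1
    rw [ucbIndex_one _ _ _ hi, EReal.coe_le_coe_iff] at h1
    have h2 := (abs_le.1 (hgood i hi)).1
    have h3 := (abs_le.1 (hgood (c t) hn)).2
    have hr : radius T τ (count c t (c t)) = √(8 * τ ^ 2 * Real.log T / count c t (c t)) :=
      if_neg h
    rw [← hr]
    have hi' : (0 : ℝ) < count c t i := by positivity
    have hn' : (0 : ℝ) < count c t (c t) := by positivity
    have h4 : m i ≤ total c v t i / count c t i + radius T τ (count c t i) := by
      rw [← sub_le_iff_le_add, le_div_iff₀ hi']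
      linarith
    have h5 : total c v t (c t) / count c t (c t) ≤
        m (c t) + radius T τ (count c t (c t)) := by
      rw [div_le_iff₀ hn']
      linarith
    linarith

/-- Links the multiplicative supermartingale to the empirical sum that enters the index. -/
lemma prod_exp_chosen {Ω X : Type*} {x : ℕ → Ω → X} {c : ℕ → Ω → ι} (V : ι → X → ℝ) (i : ι) (γ m b : ℝ) (t : ℕ) (ω : Ω) :
    ∏ s ∈ Finset.range t, (if c s ω = i then
      ENNReal.ofReal (Real.exp (γ * (V i (x s ω) - m) - b)) else 1) =
    ENNReal.ofReal (Real.exp (γ * (total (fun s => c s ω) (fun s => V (c s ω) (x s ω)) t i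
      - count (fun s => c s ω) t i * m) - count (fun s => c s ω) t i * b)) := by
  rw [← Finset.prod_filter, ← ENNReal.ofReal_prod_of_nonneg fun _ _ => (Real.exp_pos _).le,
    ← Real.exp_sum]
  congr 2
  unfold total count
  rw [Finset.sum_sub_distrib, ← Finset.mul_sum, Finset.sum_sub_distrib, Finset.sum_const,
    Finset.sum_const, nsmul_eq_mul, nsmul_eq_mul]
  rw [Finset.sum_congr rfl fun s hs => by rw [← (Finset.mem_filter.1 hs).2]]

end Combinatorics

/-! ### Concentration under adaptive choices. -/

section Concentration

variable {Ω X ι : Type*} [MeasurableSpace Ω] [MeasurableSpace X] [MeasurableSpace ι]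
  [MeasurableSingletonClass ι] [DecidableEq ι] {μ : Measure Ω} [IsProbabilityMeasure μ]
  {Q : Measure X} {T : ℕ} {x : ℕ → Ω → X} {c : ℕ → Ω → ι}

/-- Multiplying over the users served with `i` factors of mean at most one gives a
supermartingale. -/
lemma lintegral_prod_chosen_le_one (hx : ∀ t < T, Measurable (x t))
    (hc : ∀ t < T, Measurable (c t)) (hlaw : ∀ t < T, μ.map (x t) = Q)
    (hind : ∀ t < T,
      IndepFun (fun ω => ((fun s : Fin t => x s ω), (fun s : Fin (t + 1) => c s ω))) (x t) μ)
    {Y : X → ℝ≥0∞} (hY : Measurable Y) (hY1 : ∫⁻ y, Y y ∂Q ≤ 1) (i : ι) {t : ℕ} (ht : t ≤ T) :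
    ∫⁻ ω, ∏ s ∈ Finset.range t, (if c s ω = i then Y (x s ω) else 1) ∂μ ≤ 1 := by
  induction t with
  | zero => simp
  | succ t ih =>
    have htT : t < T := ht
    set W : Ω → ℝ≥0∞ := fun ω => ∏ s ∈ Finset.range t, (if c s ω = i then Y (x s ω) else 1)
      with hW
    have hWm : Measurable W := by
      refine Finset.measurable_fun_prod _ fun s hs => ?_
      have hsT := (Finset.mem_range.1 hs).trans htT
      exact Measurable.ite (hc s hsT (measurableSet_singleton i)) (hY.comp (hx s hsT))
        measurable_const
    have hset : MeasurableSet {ω | c t ω = i} := hc t htT (measurableSet_singleton i)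
    -- The indicator of choosing `i` for user `t` belongs to the past, because the choice is made
    -- before her coins are seen.
    set φ : ((Fin t → X) × (Fin (t + 1) → ι)) → ℝ≥0∞ := fun z =>
      (∏ s : Fin t, if z.2 s.castSucc = i then Y (z.1 s) else 1) *
        if z.2 (Fin.last t) = i then 1 else 0 with hφ
    have hφm : Measurable φ := by
      have hms : ∀ s : Fin (t + 1), MeasurableSet
          {z : (Fin t → X) × (Fin (t + 1) → ι) | z.2 s = i} := fun s =>
        ((measurable_pi_apply (X := fun _ => ι) s).comp
          (measurable_snd (α := Fin t → X))) (measurableSet_singleton i)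
      refine Measurable.mul (Finset.measurable_fun_prod _ fun s _ => ?_) ?_
      · exact Measurable.ite (hms _) (hY.comp ((measurable_pi_apply s).comp measurable_fst))
          measurable_const
      · exact Measurable.ite (hms _) measurable_const measurable_const
    have hφW : ∀ ω, φ ((fun s : Fin t => x s ω), (fun s : Fin (t + 1) => c s ω)) =
        W ω * if c t ω = i then 1 else 0 := by
      intro ω
      simp only [hφ, hW, Fin.val_castSucc, Fin.val_last]
      rw [Finset.prod_range]
    have hpast : Measurable fun ω => W ω * if c t ω = i then (1 : ℝ≥0∞) else 0 :=
      hWm.mul (Measurable.ite hset measurable_const measurable_const)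
    have hindep : IndepFun (fun ω => W ω * if c t ω = i then (1 : ℝ≥0∞) else 0)
        (fun ω => Y (x t ω)) μ := by
      have h := (hind t htT).comp hφm hY
      have he : φ ∘ (fun ω => ((fun s : Fin t => x s ω), (fun s : Fin (t + 1) => c s ω))) =
          fun ω => W ω * if c t ω = i then (1 : ℝ≥0∞) else 0 := funext hφW
      rwa [he] at h
    have hYx : ∫⁻ ω, Y (x t ω) ∂μ ≤ 1 := by
      rwa [← lintegral_map hY (hx t htT), hlaw t htT]
    calc ∫⁻ ω, ∏ s ∈ Finset.range (t + 1), (if c s ω = i then Y (x s ω) else 1) ∂μ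
        = ∫⁻ ω, ((W ω * if c t ω = i then 1 else 0) * Y (x t ω) +
            W ω * if c t ω = i then 0 else 1) ∂μ := by
          refine lintegral_congr fun ω => ?_
          rw [Finset.prod_range_succ]
          split_ifs <;> simp [hW]
      _ = (∫⁻ ω, W ω * (if c t ω = i then 1 else 0) ∂μ) * (∫⁻ ω, Y (x t ω) ∂μ) +
            ∫⁻ ω, W ω * (if c t ω = i then 0 else 1) ∂μ := by
          refine (lintegral_add_left (hpast.mul (hY.comp (hx t htT))) _).trans ?_
          congr 1
          exact lintegral_mul_eq_lintegral_mul_lintegral_of_indepFun hpast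
            (hY.comp (hx t htT)) hindep
      _ ≤ (∫⁻ ω, W ω * (if c t ω = i then 1 else 0) ∂μ) * 1 +
            ∫⁻ ω, W ω * (if c t ω = i then 0 else 1) ∂μ := by gcongr
      _ = ∫⁻ ω, W ω ∂μ := by
          rw [mul_one, ← lintegral_add_left hpast]
          refine lintegral_congr fun ω => ?_
          split_ifs <;> simp
      _ ≤ 1 := ih htT.le

/-- Markov's inequality for the supermartingale with the tilt of `exists_tilt`. The count is random,
so its value `n` is fixed within the event; `e = ±1` selects the tail. -/
lemma measure_deviation_le (hx : ∀ t < T, Measurable (x t))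
    (hc : ∀ t < T, Measurable (c t)) (hlaw : ∀ t < T, μ.map (x t) = Q)
    (hind : ∀ t < T,
      IndepFun (fun ω => ((fun s : Fin t => x s ω), (fun s : Fin (t + 1) => c s ω))) (x t) μ)
    {V : ι → X → ℝ} (hV : ∀ i, Measurable (V i)) {m : ι → ℝ} {τ : ℝ} (hτ : 0 < τ)
    (hsub : ∀ i, ∀ γ : ℝ, |γ| ≤ 1 / τ →
      ∫⁻ y, ENNReal.ofReal (Real.exp (γ * (V i y - m i) - γ ^ 2 * τ ^ 2 / 2)) ∂Q ≤ 1)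
    (hT : 0 < Real.log T) (i : ι) {t : ℕ} (ht : t ≤ T) {n : ℕ} (hn : n ≠ 0) {e : ℝ}
    (he : |e| = 1) :
    μ {ω | count (fun s => c s ω) t i = n ∧ n * radius T τ n ≤
      e * (total (fun s => c s ω) (fun s => V (c s ω) (x s ω)) t i - n * m i)} ≤
      ENNReal.ofReal (1 / (T : ℝ) ^ 4) := by
  obtain ⟨γ, hγ0, hγ1, hγ⟩ := exists_tilt hτ hT hn
  have hγ' : |e * γ| ≤ 1 / τ := by rwa [abs_mul, he, one_mul, abs_of_nonneg hγ0]
  have he2 : (e * γ) ^ 2 = γ ^ 2 := by rw [mul_pow, ← sq_abs e, he]; ring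
  have hTpos : (0 : ℝ) < T := by
    by_contra h
    rw [le_antisymm (not_lt.1 h) (Nat.cast_nonneg T)] at hT
    simp at hT
  have hYm : Measurable fun y => ENNReal.ofReal
      (Real.exp (e * γ * (V i y - m i) - (e * γ) ^ 2 * τ ^ 2 / 2)) :=
    ((((hV i).sub_const _).const_mul _).sub_const _).exp.ennreal_ofReal
  have h1 := lintegral_prod_chosen_le_one hx hc hlaw hind hYm (hsub i _ hγ') i ht
  simp_rw [prod_exp_chosen V i] at h1
  set Z : Ω → ℝ≥0∞ := fun ω => ENNReal.ofReal (Real.exp (e * γ *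
    (total (fun s => c s ω) (fun s => V (c s ω) (x s ω)) t i - count (fun s => c s ω) t i * m i)
    - count (fun s => c s ω) t i * ((e * γ) ^ 2 * τ ^ 2 / 2))) with hZ
  have h2 : ENNReal.ofReal ((T : ℝ) ^ 4) * μ {ω | count (fun s => c s ω) t i = n ∧
      n * radius T τ n ≤
      e * (total (fun s => c s ω) (fun s => V (c s ω) (x s ω)) t i - n * m i)} ≤ 1 := by
    refine le_trans ?_ ((mul_meas_ge_le_lintegral₀ ?_ (ENNReal.ofReal ((T : ℝ) ^ 4))).trans h1)
    · refine mul_le_mul_right (measure_mono fun ω hω => ?_) _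
      obtain ⟨hω1, hω2⟩ := hω
      simp only [Set.mem_ofPred_eq, hω1, he2]
      refine ENNReal.ofReal_le_ofReal ?_
      rw [← Real.exp_log (pow_pos hTpos 4), Real.log_pow]
      refine Real.exp_le_exp.2 (hγ.trans' ?_ |>.trans ?_)
      · exact le_of_eq (by push_cast; ring)
      · nlinarith [mul_le_mul_of_nonneg_left hω2 hγ0]
    · have : Z = fun ω => ∏ s ∈ Finset.range t, (if c s ω = i then
          ENNReal.ofReal (Real.exp (e * γ * (V i (x s ω) - m i) - (e * γ) ^ 2 * τ ^ 2 / 2))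
          else 1) := funext fun ω => (prod_exp_chosen V i _ _ _ t ω).symm
      change AEMeasurable Z μ
      rw [this]
      refine (Finset.measurable_fun_prod _ fun s hs => ?_).aemeasurable
      have hsT := (Finset.mem_range.1 hs).trans_le ht
      exact Measurable.ite (hc s hsT (measurableSet_singleton i)) (hYm.comp (hx s hsT))
        measurable_const
  rw [one_div, ENNReal.ofReal_inv_of_pos (by positivity)]
  rw [mul_comm] at h2
  rw [← one_div]
  exact (ENNReal.le_div_iff_mul_le (Or.inl (ENNReal.ofReal_pos.2 (by positivity)).ne') (Or.inl ENNReal.ofReal_ne_top)).2 h2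

end Concentration

/-! ### From confidence bounds to regret. -/

section Bandit

variable {Ω X ι : Type*} [MeasurableSpace Ω] [MeasurableSpace X] [MeasurableSpace ι]
  [MeasurableSingletonClass ι] [DecidableEq ι] [Fintype ι] {μ : Measure Ω} [IsProbabilityMeasure μ]
  {Q : Measure X} {T : ℕ} {x : ℕ → Ω → X} {c : ℕ → Ω → ι}

/-- The probability that some confidence bound is violated. -/
lemma exists_confidence_violation_set (hx : ∀ t < T, Measurable (x t))
    (hc : ∀ t < T, Measurable (c t)) (hlaw : ∀ t < T, μ.map (x t) = Q)
    (hind : ∀ t < T,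
      IndepFun (fun ω => ((fun s : Fin t => x s ω), (fun s : Fin (t + 1) => c s ω))) (x t) μ)
    {V : ι → X → ℝ} (hV : ∀ i, Measurable (V i)) {m : ι → ℝ} {τ : ℝ} (hτ : 0 < τ)
    (hsub : ∀ i, ∀ γ : ℝ, |γ| ≤ 1 / τ →
      ∫⁻ y, ENNReal.ofReal (Real.exp (γ * (V i y - m i) - γ ^ 2 * τ ^ 2 / 2)) ∂Q ≤ 1)
    (hT : 0 < Real.log T) :
    ∃ B : Set Ω, MeasurableSet B ∧ μ.real B ≤ 2 * Fintype.card ι / (T : ℝ) ^ 2 ∧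
      ∀ ω ∉ B, ∀ t < T, ∀ i, count (fun s => c s ω) t i ≠ 0 →
        |total (fun s => c s ω) (fun s => V (c s ω) (x s ω)) t i -
            count (fun s => c s ω) t i * m i| ≤
          count (fun s => c s ω) t i * radius T τ (count (fun s => c s ω) t i) := by
  have hTpos : (0 : ℝ) < T := by
    by_contra h
    rw [le_antisymm (not_lt.1 h) (Nat.cast_nonneg T)] at hT
    simp at hT
  set E : ℕ × ι × ℕ × ℝ → Set Ω := fun z =>
    {ω | count (fun s => c s ω) z.1 z.2.1 = z.2.2.1 ∧ z.2.2.1 * radius T τ z.2.2.1 ≤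
      z.2.2.2 * (total (fun s => c s ω) (fun s => V (c s ω) (x s ω)) z.1 z.2.1 -
        z.2.2.1 * m z.2.1)} with hE
  -- Union over time, arm, value of the count and sign: about `2KT²` events of probability at most
  -- `T⁻⁴` each.
  set J : Finset (ℕ × ι × ℕ × ℝ) :=
    Finset.range T ×ˢ Finset.univ ×ˢ Finset.Icc 1 T ×ˢ {1, -1} with hJ
  have hcard : (J.card : ℝ) ≤ 2 * Fintype.card ι * (T : ℝ) ^ 2 := by
    have h2 : ((({1, -1} : Finset ℝ).card : ℕ) : ℝ) ≤ 2 := by exact_mod_cast Finset.card_le_two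
    rw [hJ, Finset.card_product, Finset.card_product, Finset.card_product, Finset.card_range,
      Finset.card_univ, Nat.card_Icc]
    push_cast
    calc (T : ℝ) * (Fintype.card ι * (((T + 1 - 1 : ℕ) : ℝ) * ((({1, -1} : Finset ℝ).card : ℕ) : ℝ)))
        ≤ (T : ℝ) * (Fintype.card ι * (((T + 1 - 1 : ℕ) : ℝ) * 2)) := by gcongr
      _ = _ := by simp; ring
  have hbound : μ (⋃ z ∈ J, E z) ≤ ENNReal.ofReal (2 * Fintype.card ι / (T : ℝ) ^ 2) := by
    calc μ (⋃ z ∈ J, E z) ≤ ∑ z ∈ J, μ (E z) := measure_biUnion_finset_le _ _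
      _ ≤ ∑ z ∈ J, ENNReal.ofReal (1 / (T : ℝ) ^ 4) := by
          refine Finset.sum_le_sum fun z hz => ?_
          simp only [hJ, Finset.mem_product, Finset.mem_range, Finset.mem_univ, Finset.mem_Icc,
            Finset.mem_insert, Finset.mem_singleton, true_and] at hz
          refine measure_deviation_le hx hc hlaw hind hV hτ hsub hT z.2.1 hz.1.le (by omega) ?_
          rcases hz.2.2 with h | h <;> simp [h]
      _ = ENNReal.ofReal (J.card * (1 / (T : ℝ) ^ 4)) := by
          rw [Finset.sum_const, nsmul_eq_mul, ENNReal.ofReal_mul (Nat.cast_nonneg _),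
            ENNReal.ofReal_natCast]
      _ ≤ ENNReal.ofReal (2 * Fintype.card ι / (T : ℝ) ^ 2) := by
          refine ENNReal.ofReal_le_ofReal ?_
          calc (J.card : ℝ) * (1 / (T : ℝ) ^ 4)
              ≤ 2 * Fintype.card ι * (T : ℝ) ^ 2 * (1 / (T : ℝ) ^ 4) := by gcongr
            _ = _ := by field_simp
  -- The measurable hull has the same measure, so measurability of the events need not be shown.
  refine ⟨toMeasurable μ (⋃ z ∈ J, E z), measurableSet_toMeasurable _ _, ?_, ?_⟩
  · rw [measureReal_def, measure_toMeasurable]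
    exact ENNReal.toReal_le_of_le_ofReal (by positivity) hbound
  · intro ω hω t ht i hn
    have hω' : ω ∉ ⋃ z ∈ J, E z := fun h => hω (subset_toMeasurable _ _ h)
    simp only [Set.mem_iUnion, not_exists] at hω'
    have hmem : ∀ e : ℝ, e = 1 ∨ e = -1 →
        (t, i, count (fun s => c s ω) t i, e) ∈ J := by
      intro e he
      simp only [hJ, Finset.mem_product, Finset.mem_range, Finset.mem_univ, Finset.mem_Icc,
        Finset.mem_insert, Finset.mem_singleton, true_and]
      exact ⟨ht, ⟨by omega, (count_le _ _ _).trans ht.le⟩, he⟩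
    have h1 := hω' _ (hmem 1 (Or.inl rfl))
    have h2 := hω' _ (hmem (-1) (Or.inr rfl))
    simp only [hE, Set.mem_ofPred_eq, true_and, not_le] at h1 h2
    rw [abs_le]
    constructor <;> linarith

/-- The return from a user has, given the choice, the mean of the chosen policy. -/
lemma integral_return_choice {t : ℕ} (hx : Measurable (x t)) (hc : Measurable (c t))
    (hlaw : μ.map (x t) = Q) (hind : IndepFun (c t) (x t) μ)
    {V : ι → X → ℝ} (hVint : ∀ i, Integrable (V i) Q) {m : ι → ℝ} (hm : ∀ i, ∫ y, V i y ∂Q = m i) :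
    Integrable (fun ω => V (c t ω) (x t ω)) μ ∧
      ∫ ω, V (c t ω) (x t ω) ∂μ = ∫ ω, m (c t ω) ∂μ ∧ Integrable (fun ω => m (c t ω)) μ := by
  have hset : ∀ i, MeasurableSet {ω | c t ω = i} := fun i => hc (measurableSet_singleton i)
  have hsum : ∀ f : ι → Ω → ℝ, (fun ω => f (c t ω) ω) =
      fun ω => ∑ i, (if c t ω = i then (1 : ℝ) else 0) * f i ω := by
    intro f
    funext ω
    simp
  have hone : ∀ i, Measurable fun ω => if c t ω = i then (1 : ℝ) else 0 := fun i =>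
    Measurable.ite (hset i) measurable_const measurable_const
  have hone_int : ∀ i, Integrable (fun ω => if c t ω = i then (1 : ℝ) else 0) μ := fun i =>
    Integrable.of_bound (hone i).aestronglyMeasurable 1 <| Filter.Eventually.of_forall fun ω => by
      split_ifs <;> simp
  have hVx : ∀ i, Integrable (fun ω => V i (x t ω)) μ := fun i => by
    have h := hVint i
    rw [← hlaw] at h
    exact h.comp_measurable hx
  have hVx_int : ∀ i, ∫ ω, V i (x t ω) ∂μ = m i := fun i => by
    have h := (hVint i).aestronglyMeasurable
    rw [← hlaw] at h
    rw [← integral_map hx.aemeasurable h, hlaw, hm]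
  have hindV : ∀ i, IndepFun (fun ω => if c t ω = i then (1 : ℝ) else 0)
      (fun ω => V i (x t ω)) μ := fun i => by
    have h1 : Measurable fun k : ι => if k = i then (1 : ℝ) else 0 :=
      Measurable.ite (measurableSet_singleton i) measurable_const measurable_const
    have h2 : AEMeasurable (V i) (μ.map (x t)) := by
      rw [hlaw]; exact (hVint i).aestronglyMeasurable.aemeasurable
    exact hind.comp₀ hc.aemeasurable hx.aemeasurable h1.aemeasurable h2
  have hprod : ∀ i, Integrable (fun ω => (if c t ω = i then (1 : ℝ) else 0) * V i (x t ω)) μ :=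
    fun i => (hindV i).integrable_mul (hone_int i) (hVx i)
  refine ⟨?_, ?_, ?_⟩
  · rw [hsum fun i ω => V i (x t ω)]
    exact integrable_finsetSum _ fun i _ => hprod i
  · rw [hsum fun i ω => V i (x t ω), hsum fun i _ => m i, integral_finsetSum _ fun i _ => hprod i,
      integral_finsetSum _ fun i _ => (hone_int i).mul_const (m i)]
    refine Finset.sum_congr rfl fun i _ => ?_
    rw [integral_mul_const, ← hVx_int i]
    exact (hindV i).integral_mul_eq_mul_integral (hone i).aestronglyMeasurable
      (hVx i).aestronglyMeasurable
  · rw [hsum fun i _ => m i]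
    exact integrable_finsetSum _ fun i _ => (hone_int i).mul_const (m i)

/-- The regret bound of UCB-Hybrid with `η = 1` for sub-exponential returns. -/
theorem integral_regret_le (hx : ∀ t < T, Measurable (x t))
    (hc : ∀ t < T, Measurable (c t)) (hlaw : ∀ t < T, μ.map (x t) = Q)
    (hind : ∀ t < T,
      IndepFun (fun ω => ((fun s : Fin t => x s ω), (fun s : Fin (t + 1) => c s ω))) (x t) μ)
    {V : ι → X → ℝ} (hV : ∀ i, Measurable (V i)) (hVint : ∀ i, Integrable (V i) Q) {m : ι → ℝ}
    (hm : ∀ i, ∫ y, V i y ∂Q = m i) {τ D : ℝ} (hτ : 0 < τ) (hm0 : ∀ i, 0 ≤ m i)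
    (hmD : ∀ i, m i ≤ D)
    (hsub : ∀ i, ∀ γ : ℝ, |γ| ≤ 1 / τ →
      ∫⁻ y, ENNReal.ofReal (Real.exp (γ * (V i y - m i) - γ ^ 2 * τ ^ 2 / 2)) ∂Q ≤ 1)
    (hT : 2 ≤ T)
    (hmax : ∀ t < T, ∀ ω, ∀ i,
      ucbIndex T τ 1 (count (fun s => c s ω) t i)
        (total (fun s => c s ω) (fun s => V (c s ω) (x s ω)) t i) ≤
      ucbIndex T τ 1 (count (fun s => c s ω) t (c t ω))
        (total (fun s => c s ω) (fun s => V (c s ω) (x s ω)) t (c t ω))) (b : ι) :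
    Integrable (fun ω => T * m b - ∑ t ∈ Finset.range T, V (c t ω) (x t ω)) μ ∧
      ∫ ω, (T * m b - ∑ t ∈ Finset.range T, V (c t ω) (x t ω)) ∂μ ≤
        (12 * D + 12 * τ) * (√(Fintype.card ι * T * Real.log T) + Fintype.card ι * Real.log T) := by
  have hT' : (2 : ℝ) ≤ T := by exact_mod_cast hT
  have hlog : 0 < Real.log T := Real.log_pos (by linarith)
  have hD : 0 ≤ D := (hm0 b).trans (hmD b)
  have hchoice : ∀ t < T, IndepFun (c t) (x t) μ := fun t ht => by
    have hlast : Measurable fun z : (Fin t → X) × (Fin (t + 1) → ι) => z.2 (Fin.last t) :=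
      (measurable_pi_apply (X := fun _ => ι) (Fin.last t)).comp (measurable_snd (α := Fin t → X))
    exact (hind t ht).comp hlast measurable_id
  have hR := fun t ht => integral_return_choice (hx t ht) (hc t ht) (hlaw t ht) (hchoice t ht)
    hVint hm
  have hsumint : Integrable (fun ω => ∑ t ∈ Finset.range T, V (c t ω) (x t ω)) μ :=
    integrable_finsetSum _ fun t ht => (hR t (Finset.mem_range.1 ht)).1
  have hgapint : ∀ t ∈ Finset.range T, Integrable (fun ω => m b - m (c t ω)) μ := fun t ht =>
    (integrable_const _).sub (hR t (Finset.mem_range.1 ht)).2.2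
  refine ⟨(integrable_const _).sub hsumint, ?_⟩
  -- In expectation each return may be replaced by the mean of the chosen arm, leaving only gaps to
  -- bound pathwise.
  have heq : ∫ ω, (T * m b - ∑ t ∈ Finset.range T, V (c t ω) (x t ω)) ∂μ =
      ∫ ω, ∑ t ∈ Finset.range T, (m b - m (c t ω)) ∂μ := by
    rw [integral_sub (integrable_const _) hsumint, integral_finsetSum _ hgapint,
      integral_finsetSum _ fun t ht => (hR t (Finset.mem_range.1 ht)).1]
    have h1 : ∀ t ∈ Finset.range T, ∫ ω, (m b - m (c t ω)) ∂μ =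
        m b - ∫ ω, V (c t ω) (x t ω) ∂μ := by
      intro t ht
      rw [integral_sub (integrable_const _) (hR t (Finset.mem_range.1 ht)).2.2,
        (hR t (Finset.mem_range.1 ht)).2.1]
      simp
    rw [Finset.sum_congr rfl h1, Finset.sum_sub_distrib]
    simp
  obtain ⟨B, hBm, hB, hgood⟩ := exists_confidence_violation_set hx hc hlaw hind hV hτ hsub hlog
  set G : ℝ := Fintype.card ι * (D * (8 * Real.log T + 1)) +
    4 * √(8 * τ ^ 2 * Real.log T) * √(Fintype.card ι * T) with hG
  have hG0 : 0 ≤ G := by positivity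
  have hpath : ∀ ω, ∑ t ∈ Finset.range T, (m b - m (c t ω)) ≤ G + B.indicator (fun _ => T * D) ω := by
    intro ω
    by_cases hω : ω ∈ B
    · rw [Set.indicator_of_mem hω]
      have : ∑ t ∈ Finset.range T, (m b - m (c t ω)) ≤ ∑ t ∈ Finset.range T, D :=
        Finset.sum_le_sum fun t _ => by linarith [hm0 (c t ω), hmD b]
      rw [Finset.sum_const, Finset.card_range, nsmul_eq_mul] at this
      linarith
    · rw [Set.indicator_of_notMem hω, add_zero]
      refine (Finset.sum_le_sum fun t ht => ?_).trans
        (sum_gapBound_choice_le (fun s => c s ω) T hD hlog)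
      have htT := Finset.mem_range.1 ht
      exact gap_le_gapBound hm0 hmD hlog (hmax t htT ω) (hgood ω hω t htT) b
  have hint : ∫ ω, ∑ t ∈ Finset.range T, (m b - m (c t ω)) ∂μ ≤ G + μ.real B * (T * D) := by
    have hBi : Integrable (B.indicator fun _ => (T : ℝ) * D) μ := (integrable_const _).indicator hBm
    refine (integral_mono (integrable_finsetSum _ hgapint) ((integrable_const G).add hBi)
      hpath).trans_eq ?_
    simp only [Pi.add_apply]
    rw [integral_add (integrable_const _) hBi, integral_indicator_const _ hBm]
    simp
  rw [heq]
  refine hint.trans ?_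
  set k : ℝ := (Fintype.card ι : ℝ) with hk
  have hk0 : 0 ≤ k := Nat.cast_nonneg _
  have h1 : μ.real B * (T * D) ≤ k * D := by
    calc μ.real B * (T * D) ≤ 2 * k / (T : ℝ) ^ 2 * (T * D) := by gcongr
      _ = (k * D) * (2 / T) := by field_simp
      _ ≤ (k * D) * 1 := by
          gcongr
          rw [div_le_one (by linarith)]
          exact hT'
      _ = k * D := mul_one _
  -- This absorbs the lower-order terms: `kD` from the `+ 1` in `G` and `kD` from `B` total at most
  -- `4kD log T`, whence `12 = 8 + 4`.
  have hlog2 : 1 / 2 ≤ Real.log T := by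
    have := Real.log_le_log (by norm_num) hT'
    linarith [Real.log_two_gt_d9]
  have h2 : √(8 * τ ^ 2 * Real.log T) * √(k * T) ≤ 3 * τ * √(k * T * Real.log T) := by
    rw [← Real.sqrt_mul (by positivity), show 8 * τ ^ 2 * Real.log T * (k * T) =
      τ ^ 2 * (8 * (k * T * Real.log T)) by ring, Real.sqrt_mul (by positivity),
      Real.sqrt_sq hτ.le, Real.sqrt_mul (by norm_num)]
    have : √(8 : ℝ) ≤ 3 := by rw [Real.sqrt_le_left (by norm_num)]; norm_num
    calc τ * (√8 * √(k * T * Real.log T)) ≤ τ * (3 * √(k * T * Real.log T)) := by gcongr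
      _ = _ := by ring
  have h3 : k * D * 2 ≤ k * D * (4 * Real.log T) :=
    mul_le_mul_of_nonneg_left (by linarith) (by positivity)
  have h4 : 0 ≤ D * √(k * T * Real.log T) := by positivity
  have h5 : 0 ≤ τ * (k * Real.log T) := by positivity
  rw [hG]
  linarith

end Bandit

end DepartingBandits

/-! ### Assembly for the departing-bandits instance. -/

theorem mainTheorem2 (ε : ℝ) (hε0 : 0 < ε) (hε1 : ε < 1) :
    ∃ C : ℝ, 0 < C ∧
      ∀ (K T : ℕ), 1 ≤ K → 2 ≤ T →
      ∀ (P L : Fin K → unitInterval),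
        (∀ a, 0 < (P a : ℝ) ∧ (P a : ℝ) < 1) →
        (∀ a, 0 < (L a : ℝ)) →
        (∀ a, ε ≤ (L a : ℝ) * (1 - P a)) →
        (∃ pstar : DepartingBandits.Policy K, DepartingBandits.IsOptimal P L pstar) ∧
        ∀ pstar : DepartingBandits.Policy K, DepartingBandits.IsOptimal P L pstar →
          DepartingBandits.expectedReturn P L pstar ≠ ⊤ ∧
          ∀ {Ω : Type*} [MeasurableSpace Ω] (μ : Measure Ω) [IsProbabilityMeasure μ]
            (x : ℕ → Ω → DepartingBandits.Coins K) (c : ℕ → Ω → Fin K),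
            DepartingBandits.IsUCBHybridRun P L DepartingBandits.fixedArm T
              (8 * Real.exp 1 / Real.log (1 / (1 - ε))) 1 μ x c →
            Integrable
              (DepartingBandits.regret P L pstar DepartingBandits.fixedArm T x c) μ ∧
            ∫ ω, DepartingBandits.regret P L pstar DepartingBandits.fixedArm T x c ω ∂μ ≤
              C * (√(K * T * Real.log T) + K * Real.log T) := by
  open DepartingBandits in
  set τ : ℝ := 8 * Real.exp 1 / Real.log (1 / (1 - ε)) with hτ
  have hl : 0 < Real.log (1 / (1 - ε)) :=
    Real.log_pos (by rw [one_div]; exact (one_lt_inv₀ (by linarith)).2 (by linarith))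
  have hτ0 : 0 < τ := by positivity
  have hD : 0 < (1 - ε) / ε := div_pos (by linarith) hε0
  refine ⟨12 * ((1 - ε) / ε) + 12 * τ, by positivity, ?_⟩
  intro K T hK hT P L _ _ hd
  have hd' : ∀ a, ε ≤ leaveProb P L a := hd
  have hpos : ∀ a, 0 < leaveProb P L a := fun a => hε0.trans_le (hd' a)
  have : Nonempty (Fin K) := ⟨⟨0, hK⟩⟩
  obtain ⟨b, hb⟩ := Finite.exists_max (armMean P L)
  have hbest : ∀ p : Policy K, expectedReturn P L p ≤ ENNReal.ofReal (armMean P L b) :=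
    expectedReturn_le P L (armMean_nonneg P L b) fun a => (div_le_iff₀ (hpos a)).1 (hb a)
  have hbeq : expectedReturn P L (fixedArm b) = ENNReal.ofReal (armMean P L b) :=
    expectedReturn_fixedArm P L b (hpos b)
  refine ⟨⟨fixedArm b, fun p => (hbest p).trans_eq hbeq.symm⟩, fun pstar hstar => ?_⟩
  -- Every optimal policy has the value of the best arm `b`, so regret against `pstar` is regret
  -- against `b`.
  have hval : expectedReturn P L pstar = ENNReal.ofReal (armMean P L b) :=
    le_antisymm (hbest pstar) (hbeq.symm.trans_le (hstar _))
  refine ⟨by rw [hval]; exact ENNReal.ofReal_ne_top, ?_⟩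
  intro Ω _ μ _ x c hrun
  have h := integral_regret_le hrun.measurable_coins hrun.measurable_choice hrun.law_coins
    hrun.nonanticipating (V := fun a y => (policyReturn (fixedArm a) y).toReal)
    (fun a => measurable_return_toReal _) (fun a => integrable_return_fixedArm P L a (hpos a))
    (fun a => integral_return_fixedArm P L a (hpos a)) hτ0 (armMean_nonneg P L)
    (fun a => armMean_le hε0 P L a (hd' a))
    (fun a γ hγ => lintegral_exp_return_le_one hε0 hε1 hτ P L a (hd' a) hγ) hT
    hrun.choice_mem_argmax b
  have hreg : regret P L pstar fixedArm T x c = fun ω => T * armMean P L b -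
      ∑ t ∈ Finset.range T, (policyReturn (fixedArm (c t ω)) (x t ω)).toReal := by
    funext ω
    rw [regret, hval, ENNReal.toReal_ofReal (armMean_nonneg P L b)]
  rw [hreg]
  simpa only [Fintype.card_fin] using h
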